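/- Let $\alpha>1$. There is a constant $C=C(\alpha)>0$, depending only on $\alpha$, such that the following holds for every $n\ge 1$ and every function $f$ on the positive cone $\Gamma_+=\{\kappa\in\mathbb{R}^n:\kappa_i>0 \text{ for all } i\}$ that is smooth, symmetric, has $\partial f/\partial\kappa_i>0$ for each $i$, is homogeneous of degree $1$, positive, and normalised by $f(1,\dots,1)=1$. Consider the flow that moves hypersurfaces of $\mathbb{R}^{n+1}$ in the inward normal direction with speed $f(\kappa)^\alpha$, where $\kappa$ is the vector of principal curvatures. Let $\Omega_0\subset\mathbb{R}^{n+1}$ be a bounded open convex set, $M_0=\partial\Omega_0$, and suppose that $M_0$ has a flat side in a direction $z\in S^n$: there are $y_0\in M_0$ with $\langle y_0,z\rangle=h(z):=\sup\{\langle y,z\rangle:y\in\Omega_0\}$ and $r>0$ such that the open half-ball $B_r(y_0)\cap\{y:\langle y,z\rangle<h(z)\}$ is contained in $\Omega_0$. Let $\{\Omega_t\}_{0\le t\le T}$ be any generalized solution (barrier solution) of the flow starting from this region (its initial set lies between $\Omega_0$ and $\overline{\Omega_0}$), and let $M_t=\partial\Omega_t$. Then $y_0\in M_t$ for every $t\in[0,T]$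 with $t\le C(\alpha)\,r^{1+\alpha}$. Here a barrier solution is defined as follows. A smooth subsolution (supersolution) on $[a,b]$ is a family of closed sets $U(t)\subset\mathbb{R}^{n+1}$, $a\le t\le b$, with smooth boundary depending smoothly on $t$, such that at each point of $\partial U(t)$ the principal curvatures $\kappa$ lie in $\Gamma_+$ and the inward normal velocity of $\partial U(t)$ is at least (at most) $f(\kappa)^\alpha$. A family of sets $\{\Omega_t\}_{0\le t\le T}$ is a barrier solution if, for all $[a,b]\subset[0,T]$, every smooth subsolution $U$ on $[a,b]$ with $U(a)\subset\Omega_a$ has $U(t)\subset\Omega_t$ for all $t\in[a,b]$, and every smooth supersolution $U$ on $[a,b]$ with $\Omega_a\subset U(a)$ has $\Omega_t\subset U(t)$ for all $t\in[a,b]$. -/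

import Mathlib

open Set Filter Topology
open scoped ContDiff

namespace CurvatureFlow

/-- The open positive cone `Γ₊` in `ℝⁿ`. -/
def positiveCone (n : ℕ) : Set (Fin n → ℝ) := {κ | ∀ i, 0 < κ i}

/-- The standing conditions on the function `f` of the principal curvatures; the speed of the flow
is `S = f(κ) ^ α`. (For `n = 0` there is no such `f`.) -/
structure IsSpeedFunction {n : ℕ} (f : (Fin n → ℝ) → ℝ) : Prop where
  smooth : ContDiffOn ℝ ∞ f (positiveCone n)
  symmetric : ∀ κ ∈ positiveCone n, ∀ σ : Equiv.Perm (Fin n), f (fun i => κ (σ i)) = f κ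
  increasing : ∀ κ ∈ positiveCone n, ∀ i, 0 < fderiv ℝ f κ (Pi.single i 1)
  homogeneous : ∀ κ ∈ positiveCone n, ∀ c : ℝ, 0 < c → f (c • κ) = c * f κ
  positive : ∀ κ ∈ positiveCone n, 0 < f κ
  normalised : f (fun _ => 1) = 1

/-- The time slice `Ω(t)` of a subset `Ω` of space-time. -/
def slice {E : Type*} (Ω : Set (E × ℝ)) (t : ℝ) : Set E := {x | (x, t) ∈ Ω}

/-- `κ` lists the principal curvatures at `x` of the hypersurface `{ψ = ψ x}`, with respect to the
unit normal `ν = ∇ψ / |∇ψ|`, which is the outer normal of the region `{ψ ≤ ψ x}`. The second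
fundamental form is the restriction of `D²ψ / |∇ψ|` to the tangent space `ker Dψ(x)`; `κ` is its
list of eigenvalues, for an orthonormal basis `e` of eigenvectors. Where `ψ` is smooth with nonzero
gradient such a list exists, by the spectral theorem, and it is unique up to order. -/
def IsPrincipalCurvatures {n : ℕ} (ψ : EuclideanSpace ℝ (Fin (n + 1)) → ℝ)
    (x : EuclideanSpace ℝ (Fin (n + 1))) (κ : Fin n → ℝ) : Prop :=
  ∃ e : Fin n → EuclideanSpace ℝ (Fin (n + 1)),
    Orthonormal ℝ e ∧
    (∀ i, fderiv ℝ ψ x (e i) = 0) ∧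
    ∀ i j, fderiv ℝ (fderiv ℝ ψ) x (e i) (e j) / ‖fderiv ℝ ψ x‖ = if i = j then κ i else 0

/-- The velocity at `(x, t)`, in the direction of the inner unit normal `-∇ψ / |∇ψ|`, of the
boundary of the moving region `{φ(·, t) ≤ 0}`. -/
noncomputable def inwardVelocity {n : ℕ} (φ : EuclideanSpace ℝ (Fin (n + 1)) → ℝ → ℝ)
    (x : EuclideanSpace ℝ (Fin (n + 1))) (t : ℝ) : ℝ :=
  deriv (fun s => φ x s) t / ‖fderiv ℝ (fun y => φ y t) x‖

/-- Near `(x, t)`, and for times in `[a, b]`, the set `Ω` is `{φ ≤ 0}` for a smooth function `φ`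
whose spatial gradient does not vanish. -/
structure IsLocalDefiningFunction {n : ℕ} (Ω : Set (EuclideanSpace ℝ (Fin (n + 1)) × ℝ)) (a b : ℝ)
    (φ : EuclideanSpace ℝ (Fin (n + 1)) → ℝ → ℝ)
    (x : EuclideanSpace ℝ (Fin (n + 1))) (t : ℝ) : Prop where
  smooth : ∀ᶠ p in 𝓝 (x, t), ContDiffAt ℝ ∞ (fun q : EuclideanSpace ℝ (Fin (n + 1)) × ℝ => φ q.1 q.2) p
  gradient_ne_zero : fderiv ℝ (fun y => φ y t) x ≠ 0
  mem_iff : ∀ᶠ p in 𝓝[univ ×ˢ Icc a b] (x, t), p ∈ Ω ↔ φ p.1 p.2 ≤ 0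

/-- `Ω` is a family, over the time interval `[a, b]`, of closed subsets of `ℝⁿ⁺¹` with smooth
boundary depending smoothly on time, such that at each boundary point of each slice the principal
curvatures lie in the positive cone and are related to the inward normal velocity `V` by
`R V κ`. Only points of space-time over boundary points of slices are boundary points of `Ω`
relative to `ℝⁿ⁺¹ × [a, b]` (`interior_mem`): no part of the set appears or vanishes suddenly. -/
structure IsSmoothEvolution {n : ℕ} (R : ℝ → (Fin n → ℝ) → Prop) (a b : ℝ)
    (Ω : Set (EuclideanSpace ℝ (Fin (n + 1)) × ℝ)) : Prop where
  subset : Ω ⊆ univ ×ˢ Icc a b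
  closed : IsClosed Ω
  interior_mem : ∀ t ∈ Icc a b, ∀ x ∈ interior (slice Ω t), Ω ∈ 𝓝[univ ×ˢ Icc a b] (x, t)
  boundary : ∀ t ∈ Icc a b, ∀ x ∈ frontier (slice Ω t),
    ∃ φ, IsLocalDefiningFunction Ω a b φ x t ∧
      ∀ κ, IsPrincipalCurvatures (fun y => φ y t) x κ →
        κ ∈ positiveCone n ∧ R (inwardVelocity φ x t) κ

/-- Smooth admissible subsolutions on `[a, b]`: the inward velocity is at least `f(κ) ^ α`. -/
def IsSmoothSubsolution {n : ℕ} (f : (Fin n → ℝ) → ℝ) (α a b : ℝ)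
    (Ω : Set (EuclideanSpace ℝ (Fin (n + 1)) × ℝ)) : Prop :=
  IsSmoothEvolution (fun V κ => f κ ^ α ≤ V) a b Ω

/-- Smooth admissible supersolutions on `[a, b]`: the inward velocity is at most `f(κ) ^ α`. -/
def IsSmoothSupersolution {n : ℕ} (f : (Fin n → ℝ) → ℝ) (α a b : ℝ)
    (Ω : Set (EuclideanSpace ℝ (Fin (n + 1)) × ℝ)) : Prop :=
  IsSmoothEvolution (fun V κ => V ≤ f κ ^ α) a b Ω

/-- `A` is an outer barrier on the time interval `I`: every smooth subsolution that starts inside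
`A` stays inside `A`. -/
def IsOuterBarrier {n : ℕ} (f : (Fin n → ℝ) → ℝ) (α : ℝ) (I : Set ℝ)
    (A : Set (EuclideanSpace ℝ (Fin (n + 1)) × ℝ)) : Prop :=
  A ⊆ univ ×ˢ I ∧
    ∀ a b : ℝ, a < b → Icc a b ⊆ I → ∀ Ω, IsSmoothSubsolution f α a b Ω →
      slice Ω a ⊆ slice A a → ∀ t ∈ Icc a b, slice Ω t ⊆ slice A t

/-- `A` is an inner barrier on the time interval `I`: every smooth supersolution that starts
around `A` stays around `A`. -/
def IsInnerBarrier {n : ℕ} (f : (Fin n → ℝ) → ℝ) (α : ℝ) (I : Set ℝ)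
    (A : Set (EuclideanSpace ℝ (Fin (n + 1)) × ℝ)) : Prop :=
  A ⊆ univ ×ˢ I ∧
    ∀ a b : ℝ, a < b → Icc a b ⊆ I → ∀ Ω, IsSmoothSupersolution f α a b Ω →
      slice A a ⊆ slice Ω a → ∀ t ∈ Icc a b, slice A t ⊆ slice Ω t

/-- A barrier solution (generalized solution) of the flow with speed `f(κ) ^ α` on the time
interval `I` is a set that is both an outer and an inner barrier. -/
def IsBarrierSolution {n : ℕ} (f : (Fin n → ℝ) → ℝ) (α : ℝ) (I : Set ℝ)
    (A : Set (EuclideanSpace ℝ (Fin (n + 1)) × ℝ)) : Prop :=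
  IsOuterBarrier f α I A ∧ IsInnerBarrier f α I A

/-- The support function `h(z) = sup {⟨y, z⟩ : y ∈ Ω}` (used for bounded nonempty `Ω`). -/
noncomputable def supportFunction {n : ℕ} (Ω : Set (EuclideanSpace ℝ (Fin (n + 1))))
    (z : EuclideanSpace ℝ (Fin (n + 1))) : ℝ :=
  sSup ((fun y => inner ℝ y z) '' Ω)

end CurvatureFlow

namespace CurvatureFlow

/-! Comparison with two explicit barriers traps `y₀` between the interior and the closure of each
slice.

From outside, stationary large balls are supersolutions. Balls whose boundaries flatten onto the
hyperplane through `y₀` normal to `z` keep every slice in the half-space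
(`IsInnerBarrier.inner_le`), so `y₀` is never interior.

From inside, the barrier is `⟨x - y₀, z⟩ + (T₀ + λ t) Q ^ a ≤ 0` with `Q = ‖x - y₀‖² + δ`. Its
curvatures are at most a constant times `Q ^ (a - 1)`, and its velocity is `λ Q ^ a` divided by the
gradient norm. The choice `a = α / (α - 1)`, that is `(a - 1) α = a`, makes the speed and the
velocity scale alike, so a large constant `λ` gives a subsolution
(`isSmoothSubsolution_flatBarrier`). Such an exponent needs `α > 1`. As `δ → 0` the barriers contain
points tending to `y₀`, which places `y₀` in the closure (`IsOuterBarrier.mem_closure`).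

The speed function enters only through positivity and `f κ ≤ max κᵢ`, so the constant depends on `α`
alone. -/

lemma IsSpeedFunction.le_of_forall_le {n : ℕ} {f : (Fin n → ℝ) → ℝ} (hf : IsSpeedFunction f)
    {κ : Fin n → ℝ} (hκ : κ ∈ positiveCone n) {m : ℝ} (hm : 0 < m) (hle : ∀ i, κ i ≤ m) :
    f κ ≤ m := by
  have hopen : IsOpen (positiveCone n) := by
    have : positiveCone n = ⋂ i, {κ : Fin n → ℝ | 0 < κ i} := by
      ext κ; simp [positiveCone]
    rw [this]
    exact isOpen_iInter_of_finite fun i => isOpen_lt continuous_const (continuous_apply i)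
  have hfm : f (fun _ => m) = m := by
    have h := hf.homogeneous (fun _ => 1) (fun _ => one_pos) m hm
    rw [hf.normalised, mul_one] at h
    have e : (m • fun _ => (1 : ℝ) : Fin n → ℝ) = fun _ => m := by ext i; simp
    rwa [e] at h
  -- Compare along the segment from `κ` to `(m, …, m)`: its direction has nonnegative entries, so
  -- `f` is monotone on it, and homogeneity with normalisation gives the value `m` at the end.
  set v : Fin n → ℝ := fun i => m - κ i with hv
  have hmem : ∀ s ∈ Icc (0 : ℝ) 1, κ + s • v ∈ positiveCone n := by
    intro s hs i
    have h1 := hκ i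
    have h2 := hle i
    have h3 : 0 ≤ s * (m - κ i) := mul_nonneg hs.1 (by linarith)
    simp only [Pi.add_apply, Pi.smul_apply, smul_eq_mul, hv]
    linarith
  have hder : ∀ s ∈ Icc (0 : ℝ) 1,
      HasDerivAt (fun s : ℝ => f (κ + s • v)) (fderiv ℝ f (κ + s • v) v) s := by
    intro s hs
    have hd : DifferentiableAt ℝ f (κ + s • v) :=
      ((hf.smooth _ (hmem s hs)).contDiffAt (hopen.mem_nhds (hmem s hs))).differentiableAt
        (by simp)
    have hl : HasDerivAt (fun s : ℝ => κ + s • v) v s := by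
      simpa using ((hasDerivAt_id s).smul_const v).const_add κ
    exact hd.hasFDerivAt.comp_hasDerivAt s hl
  have hmono : MonotoneOn (fun s : ℝ => f (κ + s • v)) (Icc 0 1) := by
    refine monotoneOn_of_deriv_nonneg (convex_Icc 0 1)
      (fun s hs => (hder s hs).continuousAt.continuousWithinAt)
      (fun s hs => (hder s (interior_subset hs)).differentiableAt.differentiableWithinAt) ?_
    intro s hs
    have hs' := interior_subset hs
    rw [(hder s hs').deriv]
    have hsum : v = ∑ i, v i • (Pi.single i (1 : ℝ) : Fin n → ℝ) := by
      ext j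
      simp [Finset.sum_apply, Pi.single_apply]
    rw [hsum, map_sum]
    refine Finset.sum_nonneg fun i _ => ?_
    rw [map_smul, smul_eq_mul, ← hsum]
    exact mul_nonneg (by simp only [hv]; linarith [hle i])
      (hf.increasing _ (hmem s hs') i).le
  have h := hmono (left_mem_Icc.2 zero_le_one) (right_mem_Icc.2 zero_le_one) zero_le_one
  have e0 : κ + (0 : ℝ) • v = κ := by simp
  have e1 : κ + (1 : ℝ) • v = fun _ => m := by ext i; simp [hv]
  simp only [e0, e1, hfm] at h
  exact h

/-! ### Smooth evolutions given by a global defining function -/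

lemma isSmoothEvolution_sublevel {n : ℕ} {R : ℝ → (Fin n → ℝ) → Prop} {a b : ℝ}
    {φ : EuclideanSpace ℝ (Fin (n + 1)) → ℝ → ℝ}
    (hφ : ContDiff ℝ ∞ fun q : EuclideanSpace ℝ (Fin (n + 1)) × ℝ => φ q.1 q.2)
    (hgrad : ∀ t ∈ Icc a b, ∀ x, φ x t = 0 → fderiv ℝ (fun y => φ y t) x ≠ 0)
    (hR : ∀ t ∈ Icc a b, ∀ x, φ x t = 0 → ∀ κ, IsPrincipalCurvatures (fun y => φ y t) x κ →
      κ ∈ positiveCone n ∧ R (inwardVelocity φ x t) κ) :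
    IsSmoothEvolution R a b {p | p.2 ∈ Icc a b ∧ φ p.1 p.2 ≤ 0} := by
  have hslice : ∀ t ∈ Icc a b,
      slice {p : EuclideanSpace ℝ (Fin (n + 1)) × ℝ | p.2 ∈ Icc a b ∧ φ p.1 p.2 ≤ 0} t
        = {x | φ x t ≤ 0} := by
    intro t ht
    ext x
    exact ⟨fun h => h.2, fun h => ⟨ht, h⟩⟩
  have hcont : ∀ t, Continuous fun x => φ x t := fun t =>
    hφ.continuous.comp (continuous_id.prodMk continuous_const)
  refine ⟨fun p hp => ⟨mem_univ _, hp.1⟩,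
    (isClosed_Icc.preimage continuous_snd).inter (isClosed_le hφ.continuous continuous_const),
    ?_, ?_⟩
  · intro t ht x hx
    rw [hslice t ht] at hx
    have hlt : φ x t < 0 := by
      -- A zero of `φ` interior to the slice would be a local maximum, against the nonvanishing
      -- gradient.
      refine lt_of_le_of_ne (show x ∈ {x | φ x t ≤ 0} from interior_subset hx) fun h0 => hgrad t ht x h0 ?_
      refine IsLocalMax.fderiv_eq_zero ?_
      filter_upwards [mem_interior_iff_mem_nhds.1 hx] with y hy
      exact h0 ▸ hy
    have hev : ∀ᶠ p in 𝓝 (x, t), φ p.1 p.2 < 0 :=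
      hφ.continuous.continuousAt.eventually_lt continuousAt_const hlt
    filter_upwards [nhdsWithin_le_nhds hev, self_mem_nhdsWithin] with p hp hpI
    exact ⟨hpI.2, hp.le⟩
  · intro t ht x hx
    rw [hslice t ht] at hx
    have h0 : φ x t = 0 := frontier_le_subset_eq (hcont t) continuous_const hx
    refine ⟨φ, ⟨Eventually.of_forall fun p => hφ.contDiffAt, hgrad t ht x h0, ?_⟩,
      hR t ht x h0⟩
    filter_upwards [self_mem_nhdsWithin] with p hp
    exact ⟨fun h => h.2, fun h => ⟨hp.2, h⟩⟩

/-! ### Derivatives of a linear plus a radial function, the form of both barriers -/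

section RadialPlusLinear

variable {E : Type*} [NormedAddCommGroup E] [InnerProductSpace ℝ E]

lemma hasFDerivAt_inner_add_comp_norm_sq (c z : E) {g : ℝ → ℝ} {g' : ℝ} {x : E}
    (hg : HasDerivAt g g' (‖x - c‖ ^ 2)) :
    HasFDerivAt (fun y => inner ℝ (y - c) z + g (‖y - c‖ ^ 2))
      (innerSL ℝ z + (2 * g') • innerSL ℝ (x - c)) x := by
  have h1 : HasFDerivAt (fun y : E => inner ℝ (y - c) z) (innerSL ℝ z) x := by
    have h := (innerSL ℝ z).hasFDerivAt (x := x - c) |>.comp x ((hasFDerivAt_id x).sub_const c)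
    refine (h.congr_of_eventuallyEq (Eventually.of_forall fun y => ?_)).congr_fderiv ?_
    · simp [real_inner_comm]
    · ext e; simp
  have h2 : HasFDerivAt (fun y : E => ‖y - c‖ ^ 2) (2 • innerSL ℝ (x - c)) x := by
    simpa using ((hasFDerivAt_id x).sub_const c).norm_sq
  refine (h1.add (hg.comp_hasFDerivAt x h2)).congr_fderiv ?_
  ext e
  simp
  ring

lemma fderiv_fderiv_inner_add_comp_norm_sq (c z : E) {g g' : ℝ → ℝ} {g'' : ℝ} {x : E}
    (hg : ∀ s, 0 ≤ s → HasDerivAt g (g' s) s) (hg' : HasDerivAt g' g'' (‖x - c‖ ^ 2)) (e : E) :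
    fderiv ℝ (fderiv ℝ fun y => inner ℝ (y - c) z + g (‖y - c‖ ^ 2)) x e e
      = 2 * g' (‖x - c‖ ^ 2) * ‖e‖ ^ 2 + 4 * g'' * inner ℝ (x - c) e ^ 2 := by
  have hd : (fderiv ℝ fun y => inner ℝ (y - c) z + g (‖y - c‖ ^ 2))
      = fun y => innerSL ℝ z + (2 * g' (‖y - c‖ ^ 2)) • innerSL ℝ (y - c) := by
    ext1 y
    exact (hasFDerivAt_inner_add_comp_norm_sq c z (hg _ (sq_nonneg _))).fderiv
  have h2 : HasFDerivAt (fun y : E => ‖y - c‖ ^ 2) (2 • innerSL ℝ (x - c)) x := by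
    simpa using ((hasFDerivAt_id x).sub_const c).norm_sq
  have h3 : HasFDerivAt (fun y : E => 2 * g' (‖y - c‖ ^ 2)) _ x :=
    (hg'.comp_hasFDerivAt x h2).const_mul 2
  have h4 : HasFDerivAt (fun y : E => innerSL ℝ (y - c)) (innerSL ℝ (E := E)) x := by
    have h := (innerSL ℝ (E := E)).hasFDerivAt (x := x - c) |>.comp x
      ((hasFDerivAt_id x).sub_const c)
    exact h.congr_fderiv (by ext; simp)
  have h5 : HasFDerivAt (fun y : E => innerSL ℝ z + (2 * g' (‖y - c‖ ^ 2)) • innerSL ℝ (y - c))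
      _ x := (h3.smul h4).const_add (innerSL ℝ z)
  rw [hd, h5.fderiv]
  have hee : (innerSL ℝ e) e = ‖e‖ ^ 2 := real_inner_self_eq_norm_sq e
  simp [hee, inner_sub_left]
  ring

end RadialPlusLinear

lemma IsPrincipalCurvatures.exists_unit {n : ℕ} {ψ : EuclideanSpace ℝ (Fin (n + 1)) → ℝ}
    {x : EuclideanSpace ℝ (Fin (n + 1))} {κ : Fin n → ℝ} (h : IsPrincipalCurvatures ψ x κ)
    (i : Fin n) : ∃ e : EuclideanSpace ℝ (Fin (n + 1)), ‖e‖ = 1 ∧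
      κ i = fderiv ℝ (fderiv ℝ ψ) x e e / ‖fderiv ℝ ψ x‖ := by
  obtain ⟨e, he, -, hκ⟩ := h
  exact ⟨e i, he.1 i, by simpa using (hκ i i).symm⟩

/-! ### Confinement to the half-space by stationary balls -/

lemma isSmoothSupersolution_closedBall {n : ℕ} {f : (Fin n → ℝ) → ℝ} (hf : IsSpeedFunction f)
    (α a b : ℝ) (c : EuclideanSpace ℝ (Fin (n + 1))) {R : ℝ} (hR : 0 < R) :
    IsSmoothSupersolution f α a b {p | p.2 ∈ Icc a b ∧ ‖p.1 - c‖ ^ 2 - R ^ 2 ≤ 0} := by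
  have hφ : (fun y : EuclideanSpace ℝ (Fin (n + 1)) => ‖y - c‖ ^ 2 - R ^ 2)
      = fun y => inner ℝ (y - c) 0 + (fun s : ℝ => s - R ^ 2) (‖y - c‖ ^ 2) := by
    ext y; simp
  have hg : ∀ s : ℝ, HasDerivAt (fun s : ℝ => s - R ^ 2) ((fun _ => (1 : ℝ)) s) s := fun s =>
    (hasDerivAt_id s).sub_const _
  have hgrad : ∀ x : EuclideanSpace ℝ (Fin (n + 1)), ‖x - c‖ ^ 2 - R ^ 2 = 0 →
      fderiv ℝ (fun y => ‖y - c‖ ^ 2 - R ^ 2) x ≠ 0 := by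
    intro x hx h0
    rw [hφ, (hasFDerivAt_inner_add_comp_norm_sq c 0 (hg _)).fderiv] at h0
    have h1 := congrArg (fun L => L (x - c)) h0
    simp only [map_zero, zero_add, mul_one, smul_apply, innerSL_apply_apply, zero_apply,
      real_inner_self_eq_norm_sq, smul_eq_mul] at h1
    nlinarith [sq_pos_of_pos hR]
  refine isSmoothEvolution_sublevel (φ := fun y _ => ‖y - c‖ ^ 2 - R ^ 2)
    (((contDiff_fst.sub contDiff_const).norm_sq ℝ).sub contDiff_const)
    (fun t _ x hx => hgrad x hx) ?_
  intro t _ x hx κ hκ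
  have hpos : κ ∈ positiveCone n := by
    intro i
    obtain ⟨e, he, hi⟩ := hκ.exists_unit i
    rw [hi]
    refine div_pos ?_ (norm_pos_iff.2 (hgrad x hx))
    rw [hφ, fderiv_fderiv_inner_add_comp_norm_sq c 0 (fun s _ => hg s) (hasDerivAt_const _ _), he]
    norm_num
  refine ⟨hpos, ?_⟩
  simp only [inwardVelocity, deriv_const, zero_div]
  exact Real.rpow_nonneg (hf.positive κ hpos).le α

lemma IsInnerBarrier.inner_le {n : ℕ} {f : (Fin n → ℝ) → ℝ} (hf : IsSpeedFunction f) {α T : ℝ}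
    {A : Set (EuclideanSpace ℝ (Fin (n + 1)) × ℝ)} (hA : IsInnerBarrier f α (Icc 0 T) A)
    {z y₀ : EuclideanSpace ℝ (Fin (n + 1))} (hz : ‖z‖ = 1) {D : ℝ}
    (hD : ∀ y ∈ slice A 0, ‖y - y₀‖ ≤ D) (hhalf : ∀ y ∈ slice A 0, inner ℝ (y - y₀) z ≤ 0)
    {t : ℝ} (ht0 : 0 ≤ t) (htT : t ≤ T) {x : EuclideanSpace ℝ (Fin (n + 1))}
    (hx : x ∈ slice A t) : inner ℝ (x - y₀) z ≤ 0 := by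
  rcases ht0.eq_or_lt with rfl | ht
  · exact hhalf x hx
  by_contra! hs
  set s : ℝ := inner ℝ (x - y₀) z with hs_def
  -- The ball centred at `y₀ - L z` with squared radius `L² + D²` contains the half-ball of radius
  -- `D`. A point at height `s` has squared distance at least `L² + 2 L s` from the centre, so it is
  -- excluded once `2 L s > D²`.
  set L : ℝ := (D ^ 2 + 1) / s with hL
  have hLpos : 0 < L := by positivity
  have hLs : L * s = D ^ 2 + 1 := div_mul_cancel₀ _ hs.ne'
  have hexp : ∀ y, ‖y - (y₀ - L • z)‖ ^ 2
      = ‖y - y₀‖ ^ 2 + 2 * (L * inner ℝ (y - y₀) z) + L ^ 2 := by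
    intro y
    rw [show y - (y₀ - L • z) = (y - y₀) + L • z by abel, norm_add_sq_real, inner_smul_right,
      norm_smul, hz, mul_one, Real.norm_eq_abs, sq_abs]
  have hRsq : Real.sqrt (L ^ 2 + D ^ 2) ^ 2 = L ^ 2 + D ^ 2 := Real.sq_sqrt (by positivity)
  have hmem := hA.2 0 t ht (Icc_subset_Icc_right htT) _
    (isSmoothSupersolution_closedBall hf α 0 t (y₀ - L • z)
      (R := Real.sqrt (L ^ 2 + D ^ 2)) (by positivity)) ?_ t ⟨ht.le, le_rfl⟩ hx
  · have h2 := hmem.2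
    simp only [hexp, hRsq, ← hs_def, hLs] at h2
    nlinarith [sq_nonneg ‖x - y₀‖, sq_nonneg D]
  · intro y hy
    refine ⟨⟨le_rfl, ht.le⟩, ?_⟩
    simp only [hexp, hRsq]
    have h1 : ‖y - y₀‖ ^ 2 ≤ D ^ 2 := pow_le_pow_left₀ (norm_nonneg _) (hD y hy) 2
    have h2 := mul_nonpos_of_nonneg_of_nonpos hLpos.le (hhalf y hy)
    linarith

lemma notMem_interior_of_inner_le {E : Type*} [NormedAddCommGroup E] [InnerProductSpace ℝ E]
    {S : Set E} {z y₀ : E} (hz : ‖z‖ = 1) (hS : ∀ x ∈ S, inner ℝ (x - y₀) z ≤ 0) :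
    y₀ ∉ interior S := by
  intro h
  have hc : Tendsto (fun s : ℝ => y₀ + s • z) (𝓝[>] 0) (𝓝 y₀) := by
    have : Continuous fun s : ℝ => y₀ + s • z := by fun_prop
    simpa using this.continuousAt.tendsto.mono_left (nhdsWithin_le_nhds (a := (0 : ℝ)))
  obtain ⟨s, hs, hs0⟩ :=
    ((hc.eventually (mem_interior_iff_mem_nhds.1 h)).and self_mem_nhdsWithin).exists
  have h1 := hS _ hs
  rw [add_sub_cancel_left, inner_smul_left, real_inner_self_eq_norm_sq, hz] at h1
  simp at h1
  exact absurd hs0 (not_lt.2 h1)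

/-! ### The nearly flat inner barrier -/

/-- The evolving region `{⟨x - y₀, z⟩ + (T₀ + λ t) (‖x - y₀‖² + δ) ^ a ≤ 0}` lies on the inner side
of the hyperplane through `y₀` and is nearly flat there. -/
noncomputable def flatBarrier {E : Type*} [NormedAddCommGroup E] [InnerProductSpace ℝ E]
    (y₀ z : E) (T₀ lam δ a : ℝ) (x : E) (t : ℝ) : ℝ :=
  inner ℝ (x - y₀) z + (T₀ + lam * t) * (‖x - y₀‖ ^ 2 + δ) ^ a

section FlatBarrier

variable {E : Type*} [NormedAddCommGroup E] [InnerProductSpace ℝ E]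
  {y₀ z : E} {T₀ lam δ a : ℝ}

lemma contDiff_flatBarrier (hδ : 0 < δ) :
    ContDiff ℝ ∞ fun q : E × ℝ => flatBarrier y₀ z T₀ lam δ a q.1 q.2 := by
  unfold flatBarrier
  have h1 : ContDiff ℝ ∞ fun q : E × ℝ => q.1 - y₀ := contDiff_fst.sub contDiff_const
  refine (h1.inner ℝ contDiff_const).add
    ((contDiff_const.add (contDiff_const.mul contDiff_snd)).mul ?_)
  refine ((h1.norm_sq ℝ).add contDiff_const).rpow_const_of_ne fun q => ?_
  positivity

lemma deriv_flatBarrier (x : E) (t : ℝ) :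
    deriv (fun s => flatBarrier y₀ z T₀ lam δ a x s) t = lam * (‖x - y₀‖ ^ 2 + δ) ^ a := by
  unfold flatBarrier
  simp

lemma hasDerivAt_mul_add_rpow (hδ : 0 < δ) (T a : ℝ) {s : ℝ} (hs : 0 ≤ s) :
    HasDerivAt (fun s => T * (s + δ) ^ a) (T * (a * (s + δ) ^ (a - 1))) s := by
  have h := (((hasDerivAt_id s).add_const δ).rpow_const (p := a)
    (Or.inl (by simp only [id]; positivity))).const_mul T
  refine h.congr_deriv ?_
  simp

lemma hasFDerivAt_flatBarrier (hδ : 0 < δ) (x : E) (t : ℝ) :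
    HasFDerivAt (fun y => flatBarrier y₀ z T₀ lam δ a y t)
      (innerSL ℝ (z + (2 * ((T₀ + lam * t) * (a * (‖x - y₀‖ ^ 2 + δ) ^ (a - 1)))) • (x - y₀)))
      x := by
  rw [map_add, map_smul]
  exact hasFDerivAt_inner_add_comp_norm_sq y₀ z
    (hasDerivAt_mul_add_rpow hδ (T₀ + lam * t) a (sq_nonneg ‖x - y₀‖))

lemma fderiv_fderiv_flatBarrier (hδ : 0 < δ) (x e : E) (he : ‖e‖ = 1) (t : ℝ) :
    fderiv ℝ (fderiv ℝ fun y => flatBarrier y₀ z T₀ lam δ a y t) x e e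
      = 2 * ((T₀ + lam * t) * (a * (‖x - y₀‖ ^ 2 + δ) ^ (a - 1)))
        + 4 * ((T₀ + lam * t) * (a * ((a - 1) * (‖x - y₀‖ ^ 2 + δ) ^ (a - 1 - 1))))
          * inner ℝ (x - y₀) e ^ 2 := by
  have h := fderiv_fderiv_inner_add_comp_norm_sq y₀ z (x := x)
    (fun s hs => hasDerivAt_mul_add_rpow hδ (T₀ + lam * t) a hs)
    (((hasDerivAt_mul_add_rpow hδ a (a - 1) (sq_nonneg ‖x - y₀‖))).const_mul (T₀ + lam * t)) e
  rw [he] at h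
  simpa [flatBarrier] using h

lemma hessian_flatBarrier_bounds (hδ : 0 < δ) (ha : 1 < a) (x e : E) (he : ‖e‖ = 1) {t : ℝ}
    (hT : 0 < T₀ + lam * t) :
    0 < fderiv ℝ (fderiv ℝ fun y => flatBarrier y₀ z T₀ lam δ a y t) x e e ∧
    fderiv ℝ (fderiv ℝ fun y => flatBarrier y₀ z T₀ lam δ a y t) x e e
      ≤ 2 * a * (2 * a - 1) * (T₀ + lam * t) * (‖x - y₀‖ ^ 2 + δ) ^ (a - 1) := by
  rw [fderiv_fderiv_flatBarrier hδ x e he]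
  have hq : 0 < ‖x - y₀‖ ^ 2 + δ := by positivity
  have ha1 : 0 < a - 1 := by linarith
  have ha0 : 0 < a := by linarith
  have hin : (inner ℝ (x - y₀) e : ℝ) ^ 2 ≤ ‖x - y₀‖ ^ 2 + δ := by
    have h := abs_real_inner_le_norm (x - y₀) e
    rw [he, mul_one] at h
    have := sq_le_sq' (abs_le.1 h).1 (abs_le.1 h).2
    linarith
  have hpow : (‖x - y₀‖ ^ 2 + δ) ^ (a - 1)
      = (‖x - y₀‖ ^ 2 + δ) ^ (a - 1 - 1) * (‖x - y₀‖ ^ 2 + δ) := by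
    rw [← Real.rpow_add_one hq.ne', sub_add_cancel]
  rw [hpow]
  set Q := ‖x - y₀‖ ^ 2 + δ
  set T := T₀ + lam * t
  have hP : 0 < Q ^ (a - 1 - 1) := Real.rpow_pos_of_pos hq _
  set P := Q ^ (a - 1 - 1)
  constructor
  · positivity
  · have h : 4 * (T * (a * ((a - 1) * P))) * inner ℝ (x - y₀) e ^ 2
        ≤ 4 * (T * (a * ((a - 1) * P))) * Q := by gcongr
    linear_combination h

/-- On the boundary of the region the gradient is at least `1 / 2`, if `δ` is small. -/
lemma half_le_norm_fderiv_flatBarrier (hδ : 0 < δ) (ha : 1 < a) (hz : ‖z‖ = 1) {x : E} {t : ℝ}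
    (hx : flatBarrier y₀ z T₀ lam δ a x t = 0)
    (hsmall : 4 * a * ((T₀ + lam * t) * (‖x - y₀‖ ^ 2 + δ) ^ (a - 1)) ^ 2 * δ ≤ 3 / 4) :
    1 / 2 ≤ ‖fderiv ℝ (fun y => flatBarrier y₀ z T₀ lam δ a y t) x‖ := by
  rw [(hasFDerivAt_flatBarrier hδ x t).fderiv, innerSL_apply_norm]
  have hq : 0 < ‖x - y₀‖ ^ 2 + δ := by positivity
  have hxz : inner ℝ z (x - y₀)
      = -((T₀ + lam * t) * (‖x - y₀‖ ^ 2 + δ) ^ (a - 1) * (‖x - y₀‖ ^ 2 + δ)) := by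
    rw [mul_assoc, ← Real.rpow_add_one hq.ne', sub_add_cancel, real_inner_comm]
    unfold flatBarrier at hx
    linarith
  refine abs_le_of_sq_le_sq' ?_ (norm_nonneg _) |>.2
  rw [norm_add_sq_real, hz, inner_smul_right, hxz, norm_smul, mul_pow, Real.norm_eq_abs, sq_abs]
  set U := (T₀ + lam * t) * (‖x - y₀‖ ^ 2 + δ) ^ (a - 1) with hU
  rw [show (T₀ + lam * t) * (a * (‖x - y₀‖ ^ 2 + δ) ^ (a - 1)) = a * U by rw [hU]; ring]
  -- On the zero set the squared gradient norm equals `1 - 4aU²δ + 4a(a - 1)U²‖x - y₀‖²`; the last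
  -- term is nonnegative because `a > 1`.
  have h : 0 ≤ 4 * (a * (a - 1)) * U ^ 2 * ‖x - y₀‖ ^ 2 := by
    have : 0 < a * (a - 1) := mul_pos (by linarith) (by linarith)
    positivity
  linear_combination hsmall + h

/-- In the region the penalty `T ‖x - y₀‖ ^ (2a)` is at most `‖x - y₀‖`, which bounds the distance
to `y₀`. This fits the initial barrier inside the given half-ball and bounds `Q` in the gradient
estimate. -/
lemma norm_sub_le_of_flatBarrier_nonpos (hδ : 0 < δ) (ha : 1 < a) (hz : ‖z‖ = 1) {ρ : ℝ}
    (hρ : 0 < ρ) {x : E} {t : ℝ} (hT : (1 / ρ) ^ (2 * a - 1) ≤ T₀ + lam * t)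
    (hx : flatBarrier y₀ z T₀ lam δ a x t ≤ 0) : ‖x - y₀‖ ≤ ρ := by
  by_contra! hlt
  have hN : 0 < ‖x - y₀‖ := hρ.trans hlt
  have hT0 : 0 < T₀ + lam * t := (Real.rpow_pos_of_pos (by positivity) _).trans_le hT
  have h1 : -‖x - y₀‖ ≤ inner ℝ (x - y₀) z := by
    have h := abs_real_inner_le_norm (x - y₀) z
    rw [hz, mul_one] at h
    exact (abs_le.1 h).1
  have h2 : ‖x - y₀‖ ^ (2 * a - 1) * ‖x - y₀‖ ≤ (‖x - y₀‖ ^ 2 + δ) ^ a := by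
    rw [← Real.rpow_add_one hN.ne', sub_add_cancel, Real.rpow_mul hN.le]
    exact Real.rpow_le_rpow (by positivity) (by norm_cast; linarith) (by linarith)
  have h3 : ρ ^ (2 * a - 1) < ‖x - y₀‖ ^ (2 * a - 1) :=
    Real.rpow_lt_rpow hρ.le hlt (by linarith)
  have h4 : (1 / ρ) ^ (2 * a - 1) * ρ ^ (2 * a - 1) = 1 := by
    rw [← Real.mul_rpow (by positivity) hρ.le, one_div_mul_cancel hρ.ne', Real.one_rpow]
  have h5 : 1 < (T₀ + lam * t) * ‖x - y₀‖ ^ (2 * a - 1) := by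
    exact h4.symm.trans_le (mul_le_mul_of_nonneg_right hT (Real.rpow_nonneg hρ.le _)) |>.trans_lt
      (mul_lt_mul_of_pos_left h3 hT0)
  have h6 := mul_le_mul_of_nonneg_left h2 hT0.le
  unfold flatBarrier at hx
  nlinarith

end FlatBarrier

/-- With gradient norm `G ≥ 1/2` and curvatures at most `M Q ^ (a - 1) / G`, the requirement reduces
to `M ^ α G ^ (1 - α) ≤ λ`, since `(a - 1) α = a` cancels `Q`. The factor `2 ^ (α - 1)` in `hspeed`
bounds `G ^ (1 - α)`, and `2 T₀` bounds `T₀ + λ t`. -/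
lemma isSmoothSubsolution_flatBarrier {n : ℕ} {f : (Fin n → ℝ) → ℝ} (hf : IsSpeedFunction f)
    {α a T₀ lam δ ρ b : ℝ} (hα : 1 < α) (ha : 1 < a) (haα : (a - 1) * α = a) (hδ : 0 < δ)
    (hρ : 0 < ρ) {z y₀ : EuclideanSpace ℝ (Fin (n + 1))} (hz : ‖z‖ = 1)
    (hT₀ : (1 / ρ) ^ (2 * a - 1) ≤ T₀) (hlam : 0 ≤ lam) (hT : lam * b ≤ T₀)
    (hspeed : 2 ^ (α - 1) * (2 * a * (2 * a - 1) * (2 * T₀)) ^ α ≤ lam)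
    (hsmall : 4 * a * (2 * T₀ * (ρ ^ 2 + δ) ^ (a - 1)) ^ 2 * δ ≤ 3 / 4) :
    IsSmoothSubsolution f α 0 b
      {p | p.2 ∈ Icc 0 b ∧ flatBarrier y₀ z T₀ lam δ a p.1 p.2 ≤ 0} := by
  have hT₀pos : 0 < T₀ := (Real.rpow_pos_of_pos (by positivity) _).trans_le hT₀
  have hTt : ∀ t ∈ Icc 0 b, T₀ ≤ T₀ + lam * t ∧ T₀ + lam * t ≤ 2 * T₀ := by
    intro t ht
    have h1 := mul_nonneg hlam ht.1
    have h2 := mul_le_mul_of_nonneg_left ht.2 hlam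
    constructor <;> linarith
  have hgrad : ∀ t ∈ Icc 0 b, ∀ x, flatBarrier y₀ z T₀ lam δ a x t = 0 →
      1 / 2 ≤ ‖fderiv ℝ (fun y => flatBarrier y₀ z T₀ lam δ a y t) x‖ := by
    intro t ht x hx
    obtain ⟨h1, h2⟩ := hTt t ht
    refine half_le_norm_fderiv_flatBarrier hδ ha hz hx (le_trans ?_ hsmall)
    have hN := norm_sub_le_of_flatBarrier_nonpos hδ ha hz hρ (hT₀.trans h1) hx.le
    have ha1 : 0 ≤ a - 1 := by linarith
    have hTp : 0 ≤ T₀ + lam * t := by linarith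
    gcongr
  refine isSmoothEvolution_sublevel (contDiff_flatBarrier hδ) ?_ ?_
  · intro t ht x hx h0
    have h := hgrad t ht x hx
    rw [h0, norm_zero] at h
    norm_num at h
  intro t ht x hx κ hκ
  obtain ⟨h1, h2⟩ := hTt t ht
  have hTp : 0 < T₀ + lam * t := by linarith
  have hG := hgrad t ht x hx
  set G := ‖fderiv ℝ (fun y => flatBarrier y₀ z T₀ lam δ a y t) x‖ with hGdef
  have hGp : 0 < G := by linarith
  have hq : 0 < ‖x - y₀‖ ^ 2 + δ := by positivity
  have ha1 : 0 < 2 * a - 1 := by linarith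
  have ha0 : 0 < a := by linarith
  set Q := ‖x - y₀‖ ^ 2 + δ with hQ
  have hpos : κ ∈ positiveCone n := by
    intro i
    obtain ⟨e, he, hi⟩ := hκ.exists_unit i
    rw [hi]
    exact div_pos (hessian_flatBarrier_bounds hδ ha x e he hTp).1 hGp
  set M := 2 * a * (2 * a - 1) * (2 * T₀) with hM
  have hMp : 0 < M := by positivity
  have hQa : 0 < Q ^ (a - 1) := Real.rpow_pos_of_pos hq _
  have hle : f κ ≤ M * Q ^ (a - 1) / G := by
    refine hf.le_of_forall_le hpos (by positivity) fun i => ?_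
    obtain ⟨e, he, hi⟩ := hκ.exists_unit i
    rw [hi]
    refine div_le_div_of_nonneg_right ?_ hGp.le
    refine (hessian_flatBarrier_bounds hδ ha x e he hTp).2.trans ?_
    rw [hM]
    gcongr
  refine ⟨hpos, ?_⟩
  rw [inwardVelocity, deriv_flatBarrier, ← hGdef]
  refine (Real.rpow_le_rpow (hf.positive κ hpos).le hle (by linarith)).trans ?_
  rw [le_div_iff₀ hGp, Real.div_rpow (by positivity) hGp.le, Real.mul_rpow hMp.le hQa.le,
    ← Real.rpow_mul hq.le, haα]
  have hGα : G / G ^ α ≤ 2 ^ (α - 1) := by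
    have h : G / G ^ α = (G⁻¹) ^ (α - 1) := by
      rw [Real.inv_rpow hGp.le, ← Real.rpow_neg hGp.le, neg_sub, Real.rpow_sub hGp,
        Real.rpow_one]
    rw [h]
    refine Real.rpow_le_rpow (by positivity) ?_ (by linarith)
    rw [inv_le_comm₀ hGp two_pos]
    linarith
  have hMα : 0 < M ^ α := Real.rpow_pos_of_pos hMp _
  have hQα : 0 < Q ^ a := Real.rpow_pos_of_pos hq _
  calc M ^ α * Q ^ a / G ^ α * G = G / G ^ α * M ^ α * Q ^ a := by ring
    _ ≤ 2 ^ (α - 1) * M ^ α * Q ^ a := by gcongr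
    _ ≤ lam * Q ^ a := by gcongr

/-- The speed `lam` for which `T₀ + lam t` doubles within time `(8 k) ^ (-α) r ^ (1 + α)`. -/
lemma two_rpow_mul_rpow_eq {α a k r : ℝ} (haα : (a - 1) * α = a) (hk : 0 < k) (hr : 0 < r) :
    2 ^ (α - 1) * (k * (2 * (2 / r) ^ (2 * a - 1))) ^ α
      = (2 / r) ^ (2 * a - 1) / ((8 * k) ^ (-α) * r ^ (1 + α)) := by
  have h2r : 0 < 2 / r := by positivity
  -- This exponent identity produces the time scale `r ^ (1 + α)`.
  have e1 : (2 * a - 1) * α = (2 * a - 1) + (1 + α) := by linear_combination 2 * haα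
  have e8 : (8 : ℝ) ^ α = 2 ^ (α - 1) * 2 ^ α * 2 ^ (1 + α) := by
    rw [← Real.rpow_add two_pos, ← Real.rpow_add two_pos,
      show (8 : ℝ) = 2 ^ (3 : ℝ) by norm_num, ← Real.rpow_mul two_pos.le]
    congr 1
    ring
  rw [Real.mul_rpow hk.le (by positivity), Real.mul_rpow two_pos.le (by positivity),
    ← Real.rpow_mul h2r.le, e1, Real.rpow_add h2r, Real.div_rpow two_pos.le hr.le (1 + α),
    Real.rpow_neg (by positivity), Real.mul_rpow (by norm_num) hk.le, e8]
  have hrp : 0 < r ^ (1 + α) := Real.rpow_pos_of_pos hr _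
  have hkp : 0 < k ^ α := Real.rpow_pos_of_pos hk _
  field_simp

/-! ### Persistence of `y₀` in the closure -/

lemma IsOuterBarrier.mem_closure {n : ℕ} {f : (Fin n → ℝ) → ℝ} (hf : IsSpeedFunction f)
    {α a T r t : ℝ} (hα : 1 < α) (ha : 1 < a) (haα : (a - 1) * α = a)
    {A : Set (EuclideanSpace ℝ (Fin (n + 1)) × ℝ)} (hA : IsOuterBarrier f α (Icc 0 T) A)
    {z y₀ : EuclideanSpace ℝ (Fin (n + 1))} (hz : ‖z‖ = 1) (hr : 0 < r)
    (hball : ∀ y, ‖y - y₀‖ < r → inner ℝ (y - y₀) z < 0 → y ∈ slice A 0)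
    (ht0 : 0 < t) (htT : t ≤ T)
    (ht : t ≤ (8 * (2 * a * (2 * a - 1))) ^ (-α) * r ^ (1 + α)) :
    y₀ ∈ closure (slice A t) := by
  have hk : 0 < 2 * a * (2 * a - 1) := mul_pos (by linarith) (by linarith)
  set k := 2 * a * (2 * a - 1) with hkdef
  set T₀ := (2 / r) ^ (2 * a - 1) with hT₀
  have hT₀p : 0 < T₀ := Real.rpow_pos_of_pos (by positivity) _
  set tm := (8 * k) ^ (-α) * r ^ (1 + α) with htm
  have htmp : 0 < tm := by positivity
  have hlam : 0 < T₀ / tm := by positivity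
  have hTt : T₀ / tm * t ≤ T₀ := by
    rw [div_mul_eq_mul_div, div_le_iff₀ htmp]
    gcongr
  -- Take `δ = η²`. At `y₀ - η z` the barrier function is at most `-η + 2 T₀ (2 η²) ^ a`, negative
  -- for small `η` because `2a > 1` (`hc2`); `hc1` is the smallness needed for the gradient bound.
  have key : ∀ᶠ η in 𝓝[>] (0 : ℝ), y₀ - η • z ∈ slice A t := by
    have hc1 : ∀ᶠ η in 𝓝[>] (0 : ℝ),
        4 * a * (2 * T₀ * ((r / 2) ^ 2 + η ^ 2) ^ (a - 1)) ^ 2 * η ^ 2 < 3 / 4 := by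
      refine nhdsWithin_le_nhds (ContinuousAt.eventually_lt (f := fun η : ℝ =>
        4 * a * (2 * T₀ * ((r / 2) ^ 2 + η ^ 2) ^ (a - 1)) ^ 2 * η ^ 2)
        (Continuous.continuousAt ?_) continuousAt_const (by norm_num))
      have : Continuous fun η : ℝ => ((r / 2) ^ 2 + η ^ 2) ^ (a - 1) :=
        (by fun_prop : Continuous fun η : ℝ => (r / 2) ^ 2 + η ^ 2).rpow_const
          fun _ => Or.inr (by linarith)
      fun_prop
    have hc2 : ∀ᶠ η in 𝓝[>] (0 : ℝ), 2 * T₀ * (2 ^ a * η ^ (2 * a - 1)) < 1 := by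
      refine nhdsWithin_le_nhds (ContinuousAt.eventually_lt (f := fun η : ℝ =>
        2 * T₀ * (2 ^ a * η ^ (2 * a - 1))) ?_ continuousAt_const ?_)
      · have : ContinuousAt (fun η : ℝ => η ^ (2 * a - 1)) 0 :=
          continuousAt_id.rpow_const (Or.inr (by linarith))
        fun_prop
      · rw [Real.zero_rpow (by linarith)]
        norm_num
    filter_upwards [hc1, hc2, self_mem_nhdsWithin] with η h1 h2 hη
    have hη : 0 < η := hη
    have hδ : 0 < η ^ 2 := by positivity
    have hρ : 0 < r / 2 := by positivity
    have hρT : (1 / (r / 2)) ^ (2 * a - 1) ≤ T₀ := by rw [one_div_div]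
    have hsub := isSmoothSubsolution_flatBarrier (b := t) (y₀ := y₀) hf hα ha haα hδ hρ hz hρT
      hlam.le hTt (two_rpow_mul_rpow_eq haα hk hr).le h1.le
    refine hA.2 0 t ht0 (Icc_subset_Icc_right htT) _ hsub ?_ t ⟨ht0.le, le_rfl⟩ ?_
    · intro y hy
      have hy2 := hy.2
      have hN := norm_sub_le_of_flatBarrier_nonpos hδ ha hz hρ (by simpa using hρT) hy2
      refine hball y (by linarith) ?_
      have hQ : 0 < (‖y - y₀‖ ^ 2 + η ^ 2) ^ a := Real.rpow_pos_of_pos (by positivity) _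
      have hp := mul_pos hT₀p hQ
      simp only [flatBarrier, mul_zero, add_zero] at hy2
      linarith
    · refine ⟨⟨ht0.le, le_rfl⟩, ?_⟩
      have hηa : (η ^ 2 + η ^ 2) ^ a = 2 ^ a * η ^ (2 * a - 1) * η := by
        rw [← two_mul, Real.mul_rpow two_pos.le hδ.le, mul_assoc, ← Real.rpow_add_one hη.ne',
          sub_add_cancel, Real.rpow_mul hη.le]
        norm_cast
      simp only [flatBarrier, sub_sub_cancel_left, norm_neg, norm_smul, hz, mul_one,
        Real.norm_eq_abs, sq_abs, inner_neg_left, inner_smul_left, real_inner_self_eq_norm_sq]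
      rw [hηa]
      have hB : 0 < 2 ^ a * η ^ (2 * a - 1) * η := by positivity
      have h3 : (T₀ + T₀ / tm * t) * (2 ^ a * η ^ (2 * a - 1) * η)
          ≤ 2 * T₀ * (2 ^ a * η ^ (2 * a - 1) * η) := by
        gcongr
        linarith
      have h4 := mul_lt_mul_of_pos_right h2 hη
      simp
      linarith
  have hc : Tendsto (fun η : ℝ => y₀ - η • z) (𝓝[>] 0) (𝓝 y₀) := by
    have : Continuous fun η : ℝ => y₀ - η • z := by fun_prop
    simpa using this.continuousAt.tendsto.mono_left (nhdsWithin_le_nhds (a := (0 : ℝ)))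
  exact mem_closure_of_tendsto hc key

end CurvatureFlow

theorem theorem10 (α : ℝ) (hα : 1 < α) :
    ∃ C : ℝ, 0 < C ∧
      ∀ (n : ℕ) (f : (Fin n → ℝ) → ℝ), CurvatureFlow.IsSpeedFunction f →
      ∀ Ω₀ : Set (EuclideanSpace ℝ (Fin (n + 1))),
        IsOpen Ω₀ → Bornology.IsBounded Ω₀ → Convex ℝ Ω₀ →
      ∀ z y₀ : EuclideanSpace ℝ (Fin (n + 1)), ‖z‖ = 1 → y₀ ∈ frontier Ω₀ →
        inner ℝ y₀ z = CurvatureFlow.supportFunction Ω₀ z →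
      ∀ r : ℝ, 0 < r →
        Metric.ball y₀ r ∩ {y | inner ℝ y z < CurvatureFlow.supportFunction Ω₀ z} ⊆ Ω₀ →
      ∀ (T : ℝ) (A : Set (EuclideanSpace ℝ (Fin (n + 1)) × ℝ)),
        CurvatureFlow.IsBarrierSolution f α (Set.Icc 0 T) A →
        Ω₀ ⊆ CurvatureFlow.slice A 0 → CurvatureFlow.slice A 0 ⊆ closure Ω₀ →
      ∀ t : ℝ, 0 ≤ t → t ≤ T → t ≤ C * r ^ (1 + α) →
        y₀ ∈ frontier (CurvatureFlow.slice A t) := by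
  have hα1 : 0 < α - 1 := by linarith
  set a : ℝ := α / (α - 1) with ha_def
  have ha : 1 < a := by rw [ha_def, lt_div_iff₀ hα1]; linarith
  have haα : (a - 1) * α = a := by rw [ha_def]; field_simp; ring
  have hk : 0 < 2 * a * (2 * a - 1) := mul_pos (by linarith) (by linarith)
  refine ⟨(8 * (2 * a * (2 * a - 1))) ^ (-α), by positivity, ?_⟩
  intro n f hf Ω₀ _ hbdd _ z y₀ hz hy₀ hsupp r hr hball T A hA hΩA hAΩ t ht0 htT ht
  have himage : BddAbove ((fun y => inner ℝ y z) '' Ω₀) := by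
    obtain ⟨D, hD⟩ := hbdd.exists_norm_le
    refine ⟨D, ?_⟩
    rintro _ ⟨y, hy, rfl⟩
    have h := real_inner_le_norm y z
    rw [hz, mul_one] at h
    exact h.trans (hD y hy)
  have hhalf : ∀ y ∈ CurvatureFlow.slice A 0, inner ℝ (y - y₀) z ≤ 0 := by
    intro y hy
    have hcl : closure Ω₀ ⊆ {y | inner ℝ y z ≤ CurvatureFlow.supportFunction Ω₀ z} :=
      closure_minimal (fun y hy => le_csSup himage ⟨y, hy, rfl⟩)
        (isClosed_le (by fun_prop) continuous_const)
    have h : inner ℝ y z ≤ CurvatureFlow.supportFunction Ω₀ z := hcl (hAΩ hy)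
    rw [inner_sub_left, hsupp]
    linarith
  obtain ⟨D, hD⟩ := (hbdd.closure.subset hAΩ).exists_norm_le
  have hD' : ∀ y ∈ CurvatureFlow.slice A 0, ‖y - y₀‖ ≤ D + ‖y₀‖ := fun y hy =>
    (norm_sub_le _ _).trans (add_le_add_left (hD y hy) _)
  refine ⟨?_, CurvatureFlow.notMem_interior_of_inner_le hz fun x hx =>
    hA.2.inner_le hf hz hD' hhalf ht0 htT hx⟩
  -- Barriers are compared only on intervals of positive length, so time `0` is read off from the
  -- initial inclusion.
  rcases ht0.eq_or_lt with rfl | htpos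
  · exact closure_mono hΩA hy₀.1
  · refine hA.1.mem_closure hf hα ha haα hz hr (fun y hy hyz => hΩA (hball ⟨?_, ?_⟩)) htpos htT ht
    · rwa [mem_ball_iff_norm]
    · rw [inner_sub_left, hsupp] at hyz
      exact sub_neg.1 hyz
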